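/- Let $d\ge 1$, $\lambda=(\lambda_1,\dots,\lambda_d)\in\mathbb R^d$, $\tau=(\tau_1,\dots,\tau_d)\in\mathbb R^d$, and for $r>0$ define the Fisher–Bingham integral $$f(\lambda,\tau,r)=\int_{S^{d-1}(r)}\exp\Bigl(\sum_{i=1}^d\lambda_i t_i^2+\sum_{i=1}^d\tau_i t_i\Bigr)\,d\mathbf t,$$ where $S^{d-1}(r)=\{\mathbf t\in\mathbb R^d: t_1^2+\dots+t_d^2=r^2\}$ and $d\mathbf t$ is the surface measure of $S^{d-1}(r)$, of total mass $r^{d-1}\,2\pi^{d/2}/\Gamma(d/2)$. Suppose that $0>\lambda_1>\lambda_2\ge\dots\ge\lambda_d$ (for $d=1$: $0>\lambda_1$). Then, for every $r>0$, the partial derivatives of $f$ with respect to each $\lambda_j$ and each $\tau_j$ exist at $(\lambda,\tau)$, and, with $\lambda,\tau$ fixed, as $r\to\infty$, $$f(\lambda,\tau,r)=\frac{\pi^{(d-1)/2}}{\prod_{i=2}^d(\lambda_1-\lambda_i)^{1/2}}\,(e^{r\tau_1}+e^{-r\tau_1})\exp\Bigl(r^2\lambda_1-\sum_{i=2}^d\frac{\tau_i^2}{4(\lambda_i-\lambda_1)}\Bigr)(1+o(1)),$$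 $$\partial_{\lambda_1}f(\lambda,\tau,r)=r^2f(\lambda,\tau,r)(1+o(1)),$$ $$\partial_{\lambda_j}f(\lambda,\tau,r)=\Bigl\{\Bigl(\frac{\tau_j}{2(\lambda_j-\lambda_1)}\Bigr)^2+\frac1{2(\lambda_1-\lambda_j)}\Bigr\}f(\lambda,\tau,r)(1+o(1)),\quad j=2,\dots,d,$$ $$\partial_{\tau_1}f(\lambda,\tau,r)=r\,\frac{e^{r\tau_1}-e^{-r\tau_1}}{e^{r\tau_1}+e^{-r\tau_1}}\,f(\lambda,\tau,r)(1+o(1)),$$ $$\partial_{\tau_j}f(\lambda,\tau,r)=\frac{\tau_j}{2(\lambda_1-\lambda_j)}\,f(\lambda,\tau,r)(1+o(1)),\quad j=2,\dots,d.$$ Where a coefficient on the right vanishes ($\tau_1=0$ or $\tau_j=0$), the corresponding formula means that the derivative is $0$ for all sufficiently large $r$. -/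

import Mathlib

open MeasureTheory

/-- The surface measure (volume element) of the sphere of radius `r > 0` centred at the origin of
`ℝ^(n+1)`, as a measure on the ambient space: the surface measure of the unit sphere, transported
by `u ↦ r • u` and multiplied by `r ^ n`. -/
noncomputable def sphereSurfaceMeasure (n : ℕ) (r : ℝ) :
    Measure (EuclideanSpace ℝ (Fin (n + 1))) :=
  ENNReal.ofReal (r ^ n) •
    ((volume : Measure (EuclideanSpace ℝ (Fin (n + 1)))).toSphere).map
      (fun u : Metric.sphere (0 : EuclideanSpace ℝ (Fin (n + 1))) 1 =>
        r • (u : EuclideanSpace ℝ (Fin (n + 1))))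

/-- The Fisher–Bingham integral over the sphere of radius `r` in dimension `d = n + 1`. -/
noncomputable def fisherBingham {n : ℕ} (lam tau : Fin (n + 1) → ℝ) (r : ℝ) : ℝ :=
  ∫ t, Real.exp (∑ i, lam i * t i ^ 2 + ∑ i, tau i * t i) ∂(sphereSurfaceMeasure n r)

/-- The partial derivative of the Fisher–Bingham integral with respect to `lam j`. -/
noncomputable def fisherBinghamDerivLam {n : ℕ} (j : Fin (n + 1)) (lam tau : Fin (n + 1) → ℝ)
    (r : ℝ) : ℝ :=
  deriv (fun x => fisherBingham (Function.update lam j x) tau r) (lam j)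

/-- The partial derivative of the Fisher–Bingham integral with respect to `tau j`. -/
noncomputable def fisherBinghamDerivTau {n : ℕ} (j : Fin (n + 1)) (lam tau : Fin (n + 1) → ℝ)
    (r : ℝ) : ℝ :=
  deriv (fun x => fisherBingham lam (Function.update tau j x) r) (tau j)

/-! On the sphere, `∑ λ_i t_i² = r² λ_1 - ∑_{i≥2} (λ_1 - λ_i) t_i²`, so the density concentrates at
bounded distance from the two poles `(±r, 0)`, and near each pole it looks Gaussian in the remaining
coordinates. Gnomonic projection makes this exact: `z ↦ σ • (±r, z)` with `σ = gnomonicScale r z`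
maps all of `ℝ^n` onto an open hemisphere, and the surface measure becomes `σ^(n+1) dz`
(`integral_sphereSurfaceMeasure`). The domain no longer depends on `r`, so no localization is
needed.

After division by the density at the pole, the integrand converges pointwise to a Gaussian, and
dominated convergence applies (`tendsto_integral_gnomonic`). The majorant comes from `σ ≤ (1 + T)(1
+ ‖z‖²)^(-1/2)`, `T = ∑ (σ z_i)²`: Gaussian decay in `T` absorbs every power of `1 + T`, and what
remains is a constant times `(1 + ‖z‖²)^(-(n+1)/2)`, integrable over `ℝ^n`.

Differentiation under the integral turns the partial derivatives into moments with weights `t_j²`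
and `t_j`. Both hemispheres give the same Gaussian limit, so weights even in `t_0` lead to a
weighted average (`tendsto_weighted_average`) and the odd weight `t_0` to a weighted difference
(`tendsto_weighted_difference`). If a coefficient vanishes, an exact symmetry makes the derivative
zero. -/

/-- The point of `ℝ^(n+1)` with first coordinate `s` and remaining coordinates `z`. -/
noncomputable def consVec {n : ℕ} (s : ℝ) (z : Fin n → ℝ) : EuclideanSpace ℝ (Fin (n + 1)) :=
  WithLp.toLp 2 (Fin.cons s z)

/-- The factor which projects `consVec (± r) z` radially onto the sphere of radius `r`. -/
noncomputable def gnomonicScale {n : ℕ} (r : ℝ) (z : Fin n → ℝ) : ℝ :=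
  (√(1 + ∑ i, (z i / r) ^ 2))⁻¹

/-! ### Coordinates and the gnomonic scale factor. -/

section Basic

variable {n : ℕ}

@[simp]
lemma consVec_zero (s : ℝ) (z : Fin n → ℝ) : consVec s z 0 = s := rfl

@[simp]
lemma consVec_succ (s : ℝ) (z : Fin n → ℝ) (i : Fin n) : consVec s z i.succ = z i := rfl

lemma smul_consVec (c s : ℝ) (z : Fin n → ℝ) : c • consVec s z = consVec (c * s) (c • z) := by
  ext i
  refine Fin.cases ?_ (fun j => ?_) i <;> simp

lemma continuous_consVec : Continuous fun p : ℝ × (Fin n → ℝ) => consVec p.1 p.2 := by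
  refine (PiLp.continuous_toLp 2 _).comp (continuous_pi fun i => ?_)
  refine Fin.cases ?_ (fun j => ?_) i
  · simpa using continuous_fst
  · exact (continuous_apply j).comp continuous_snd

@[fun_prop]
lemma Continuous.consVec {X : Type*} [TopologicalSpace X] {s : X → ℝ} {z : X → Fin n → ℝ}
    (hs : Continuous s) (hz : Continuous z) : Continuous fun x => consVec (s x) (z x) :=
  continuous_consVec.comp (hs.prodMk hz)

lemma norm_consVec_sq (s : ℝ) (z : Fin n → ℝ) : ‖consVec s z‖ ^ 2 = s ^ 2 + ∑ i, z i ^ 2 := by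
  simp [EuclideanSpace.real_norm_sq_eq, Fin.sum_univ_succ]

lemma one_add_sum_div_sq_pos (r : ℝ) (z : Fin n → ℝ) : 0 < 1 + ∑ i, (z i / r) ^ 2 := by
  have : 0 ≤ ∑ i, (z i / r) ^ 2 := Finset.sum_nonneg fun i _ => sq_nonneg _
  linarith

lemma gnomonicScale_pos (r : ℝ) (z : Fin n → ℝ) : 0 < gnomonicScale r z :=
  inv_pos.2 (Real.sqrt_pos.2 (one_add_sum_div_sq_pos r z))

lemma gnomonicScale_le_one (r : ℝ) (z : Fin n → ℝ) : gnomonicScale r z ≤ 1 := by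
  refine inv_le_one_of_one_le₀ (Real.one_le_sqrt.2 ?_)
  have : 0 ≤ ∑ i, (z i / r) ^ 2 := Finset.sum_nonneg fun i _ => sq_nonneg _
  linarith

@[fun_prop]
lemma continuous_gnomonicScale (r : ℝ) : Continuous (gnomonicScale (n := n) r) := by
  unfold gnomonicScale
  refine Continuous.inv₀ (by fun_prop) fun z => ?_
  exact (Real.sqrt_pos.2 (one_add_sum_div_sq_pos r z)).ne'

/-- This says that `σ • (±r, z)` lies on the sphere of radius `r`; in the form `r² (1 - σ²) = ∑ (σ
z_i)²` it drives the later estimates. -/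
lemma gnomonicScale_sq_mul {r : ℝ} (hr : r ≠ 0) (z : Fin n → ℝ) :
    gnomonicScale r z ^ 2 * (r ^ 2 + ∑ i, z i ^ 2) = r ^ 2 := by
  have h := one_add_sum_div_sq_pos r z
  have h2 : r ^ 2 + ∑ i, z i ^ 2 = r ^ 2 * (1 + ∑ i, (z i / r) ^ 2) := by
    simp only [div_pow, ← Finset.sum_div]
    field_simp
  rw [h2, gnomonicScale, inv_pow, Real.sq_sqrt h.le]
  field_simp

lemma norm_consVec_eq_inv_gnomonicScale {ε : ℝ} (hε : ε ^ 2 = 1) (z : Fin n → ℝ) :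
    ‖consVec ε z‖ = (gnomonicScale 1 z)⁻¹ := by
  rw [gnomonicScale, inv_inv, eq_comm, Real.sqrt_eq_iff_mul_self_eq_of_pos]
  · simp [← sq, norm_consVec_sq, hε]
  · rw [norm_pos_iff]
    intro h
    have := norm_consVec_sq ε z
    have h' : 0 ≤ ∑ i, z i ^ 2 := Finset.sum_nonneg fun i _ => sq_nonneg _
    rw [h, hε] at this
    simp at this
    linarith

lemma gnomonicScale_one_inv_smul (r : ℝ) (z : Fin n → ℝ) :
    gnomonicScale 1 (r⁻¹ • z) = gnomonicScale r z := by
  simp [gnomonicScale, div_eq_inv_mul]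

end Basic

/-! ### Gnomonic formula for the measure of a subset of the unit sphere. -/

section Measure

open scoped Pointwise ENNReal
open Set

variable {n : ℕ}

lemma volume_eq_lintegral_consVec {A : Set (EuclideanSpace ℝ (Fin (n + 1)))}
    (hA : MeasurableSet A) :
    volume A = ∫⁻ s : ℝ, ∫⁻ z : Fin n → ℝ, A.indicator 1 (consVec s z) := by
  have h1 := (volume_preserving_piFinSuccAbove (fun _ : Fin (n + 1) => ℝ) 0).symm
  have h2 := (PiLp.volume_preserving_toLp (Fin (n + 1))).comp h1
  have hm : Measurable (A.indicator (1 : EuclideanSpace ℝ (Fin (n + 1)) → ℝ≥0∞)) := measurable_one.indicator hA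
  rw [← lintegral_indicator_one hA, ← h2.lintegral_comp hm]
  change ∫⁻ p, _ ∂((volume : Measure ℝ).prod (volume : Measure (Fin n → ℝ))) = _
  refine (lintegral_prod _ (hm.comp h2.measurable).aemeasurable).trans ?_
  refine lintegral_congr fun s => lintegral_congr fun z => ?_
  refine congrArg (A.indicator 1) ?_
  ext i
  refine Fin.cases ?_ (fun j => ?_) i <;> simp [MeasurableEquiv.piFinSuccAbove]

/-- Splits a cone into its two halves; the slice `s = 0` over the equator is null. -/
lemma lintegral_eq_lintegral_Ioi_add_neg {F : ℝ → ℝ≥0∞} (hF : Measurable F) :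
    ∫⁻ s, F s = (∫⁻ s in Ioi 0, F s) + ∫⁻ s in Ioi 0, F (-s) := by
  rw [← lintegral_add_compl F measurableSet_Ioi (A := Ioi (0 : ℝ)), compl_Ioi,
    ← setLIntegral_congr Iio_ae_eq_Iic]
  congr 1
  rw [← (Measure.measurePreserving_neg (volume : Measure ℝ)).setLIntegral_comp_preimage
    measurableSet_Iio hF]
  simp

lemma lintegral_eq_ofReal_pow_mul_lintegral_comp_smul {H : (Fin n → ℝ) → ℝ≥0∞}
    (hH : Measurable H) {s : ℝ} (hs : 0 < s) :
    ∫⁻ z, H z = ENNReal.ofReal (s ^ n) * ∫⁻ y, H (s • y) := by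
  have h := Measure.map_addHaar_smul (volume : Measure (Fin n → ℝ)) hs.ne'
  rw [← lintegral_map (g := fun y => s • y) hH (by fun_prop), h, lintegral_smul_measure,
    smul_eq_mul, ← mul_assoc, ← ENNReal.ofReal_mul (by positivity),
    abs_of_pos (by positivity)]
  simp [hs.ne']

/-- `Measure.toSphere` is the dimension times the volume of this cone; the right-hand side can be
tested in coordinates. -/
lemma mem_Ioo_smul_sphere_iff {E : Type*} [NormedAddCommGroup E] [NormedSpace ℝ E] {B : Set E}
    {v : E} : v ∈ Ioo (0 : ℝ) 1 • ((↑) '' ((↑) ⁻¹' B : Set (Metric.sphere (0 : E) 1)) : Set E) ↔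
      v ≠ 0 ∧ ‖v‖ < 1 ∧ ‖v‖⁻¹ • v ∈ B := by
  constructor
  · rintro ⟨c, ⟨hc0, hc1⟩, _, ⟨u, hu, rfl⟩, rfl⟩
    have hu1 : ‖(u : E)‖ = 1 := by simp
    have hn : ‖c • (u : E)‖ = c := by rw [norm_smul, hu1, Real.norm_of_nonneg hc0.le, mul_one]
    have : (u : E) ≠ 0 := by
      rw [← norm_pos_iff, hu1]
      exact one_pos
    simp only [hn]
    refine ⟨smul_ne_zero hc0.ne' this, hc1, ?_⟩
    rwa [smul_smul, inv_mul_cancel₀ hc0.ne', one_smul]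
  · rintro ⟨h0, h1, hB⟩
    have hn := norm_pos_iff.2 h0
    refine ⟨‖v‖, ⟨hn, h1⟩, ‖v‖⁻¹ • v, ⟨⟨‖v‖⁻¹ • v, ?_⟩, hB, rfl⟩, ?_⟩
    · simp [norm_smul, hn.ne']
    · simp [smul_smul, hn.ne']

lemma lintegral_Ioi_pow_indicator_Iio {k : ℝ} (hk : 0 < k) :
    ∫⁻ s in Ioi (0 : ℝ), ENNReal.ofReal (s ^ n) * (Iio k).indicator 1 s =
      ENNReal.ofReal (k ^ (n + 1) / (n + 1)) := by
  have : ∀ s : ℝ, ENNReal.ofReal (s ^ n) * (Iio k).indicator (1 : ℝ → ℝ≥0∞) s =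
      (Iio k).indicator (fun s => ENNReal.ofReal (s ^ n)) s := fun s => by
    by_cases h : s ∈ Iio k <;> simp [h]
  simp only [this]
  rw [setLIntegral_indicator measurableSet_Iio, Iio_inter_Ioi, setLIntegral_congr Ioo_ae_eq_Ioc,
    ← ofReal_integral_eq_lintegral_ofReal, ← intervalIntegral.integral_of_le hk.le, integral_pow]
  · simp
  · exact (continuous_pow n).integrableOn_Ioc
  · filter_upwards [ae_restrict_mem measurableSet_Ioc] with s hs
    exact pow_nonneg hs.1.le n

/-- Slice the half cone at height `s` and put `z = s • y`, with Jacobian `s^n`. The point `s • (ε,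
y)` has norm `s / σ` with `σ = gnomonicScale 1 y`, and its direction does not depend on `s`; so the
inner integral is `∫_0^σ s^n ds = σ^(n+1) / (n+1)`, whose denominator cancels the dimension factor.
-/
lemma lintegral_halfCone {B : Set (EuclideanSpace ℝ (Fin (n + 1)))} (hB : MeasurableSet B)
    {A : Set (EuclideanSpace ℝ (Fin (n + 1)))} (hA : MeasurableSet A)
    (hAB : ∀ v, v ∈ A ↔ v ≠ 0 ∧ ‖v‖ < 1 ∧ ‖v‖⁻¹ • v ∈ B) {ε : ℝ} (hε : ε ^ 2 = 1) :
    ((n + 1 : ℕ) : ℝ≥0∞) *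
        ∫⁻ s in Ioi (0 : ℝ), ∫⁻ z : Fin n → ℝ, A.indicator 1 (consVec (s * ε) z) =
      ∫⁻ y : Fin n → ℝ, ENNReal.ofReal (gnomonicScale 1 y ^ (n + 1)) *
        B.indicator 1 (gnomonicScale 1 y • consVec ε y) := by
  have key : ∀ s ∈ Ioi (0 : ℝ), ∫⁻ z : Fin n → ℝ,
      A.indicator (1 : EuclideanSpace ℝ (Fin (n + 1)) → ℝ≥0∞) (consVec (s * ε) z) =
      ∫⁻ y : Fin n → ℝ, B.indicator 1 (gnomonicScale 1 y • consVec ε y) *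
        (ENNReal.ofReal (s ^ n) * (Iio (gnomonicScale 1 y)).indicator 1 s) := by
    intro s hs
    have hs : 0 < s := hs
    rw [lintegral_eq_ofReal_pow_mul_lintegral_comp_smul _ hs, ← lintegral_const_mul]
    · refine lintegral_congr fun y => ?_
      have hk := gnomonicScale_pos 1 y
      have hn : ‖consVec (s * ε) (s • y)‖ = s * (gnomonicScale 1 y)⁻¹ := by
        rw [← smul_consVec, norm_smul, norm_consVec_eq_inv_gnomonicScale hε,
          Real.norm_of_nonneg hs.le]
      have hv : ‖consVec (s * ε) (s • y)‖⁻¹ • consVec (s * ε) (s • y) =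
          gnomonicScale 1 y • consVec ε y := by
        rw [hn, ← smul_consVec, smul_smul]
        congr 1
        field_simp
      have h0 : consVec (s * ε) (s • y) ≠ 0 := by
        rw [← norm_pos_iff, hn]
        positivity
      have hlt : s * (gnomonicScale 1 y)⁻¹ < 1 ↔ s < gnomonicScale 1 y := by
        rw [← div_eq_mul_inv, div_lt_one hk]
      have := hAB (consVec (s * ε) (s • y))
      rw [hv, hn, hlt] at this
      by_cases h1 : s < gnomonicScale 1 y <;>
        by_cases h2 : gnomonicScale 1 y • consVec ε y ∈ B <;>
        simp [indicator, this, h0, h1, h2]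
    · refine (measurable_one.indicator hA).comp (Continuous.measurable ?_)
      fun_prop
    · refine (measurable_one.indicator hA).comp (Continuous.measurable ?_)
      fun_prop
  have hBm : Measurable fun y : Fin n → ℝ =>
      B.indicator (1 : EuclideanSpace ℝ (Fin (n + 1)) → ℝ≥0∞) (gnomonicScale 1 y • consVec ε y) :=
    (measurable_one.indicator hB).comp (Continuous.measurable (by fun_prop))
  rw [setLIntegral_congr_fun measurableSet_Ioi key, lintegral_lintegral_swap,
    ← lintegral_const_mul' _ _ (by simp)]
  · refine lintegral_congr fun y => ?_
    rw [lintegral_const_mul _ ?_, lintegral_Ioi_pow_indicator_Iio (gnomonicScale_pos 1 y)]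
    · have : ENNReal.ofReal (gnomonicScale 1 y ^ (n + 1)) =
          ((n + 1 : ℕ) : ℝ≥0∞) * ENNReal.ofReal (gnomonicScale 1 y ^ (n + 1) / (n + 1)) := by
        rw [← ENNReal.ofReal_natCast, ← ENNReal.ofReal_mul (by positivity)]
        congr 1
        push_cast
        field_simp
      rw [this]
      ring
    · refine Measurable.mul (by fun_prop) (measurable_one.indicator measurableSet_Iio)
  · have hset : MeasurableSet {p : ℝ × (Fin n → ℝ) | p.1 < gnomonicScale 1 p.2} :=
      measurableSet_lt measurable_fst
        ((continuous_gnomonicScale 1).measurable.comp measurable_snd)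
    refine Measurable.aemeasurable ?_
    refine (hBm.comp measurable_snd).mul (Measurable.mul (by fun_prop) ?_)
    exact (measurable_one (α := ℝ≥0∞)).indicator hset

/-- Gnomonic parametrization of the surface measure of the unit sphere. -/
lemma toSphere_preimage_eq_lintegral {B : Set (EuclideanSpace ℝ (Fin (n + 1)))}
    (hB : MeasurableSet B) :
    (volume : Measure (EuclideanSpace ℝ (Fin (n + 1)))).toSphere ((↑) ⁻¹' B) =
      (∫⁻ y : Fin n → ℝ, ENNReal.ofReal (gnomonicScale 1 y ^ (n + 1)) *
        B.indicator 1 (gnomonicScale 1 y • consVec 1 y)) +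
      ∫⁻ y : Fin n → ℝ, ENNReal.ofReal (gnomonicScale 1 y ^ (n + 1)) *
        B.indicator 1 (gnomonicScale 1 y • consVec (-1) y) := by
  have hAB := fun v => mem_Ioo_smul_sphere_iff (B := B) (v := v)
  have hA : MeasurableSet (Ioo (0 : ℝ) 1 • ((↑) '' ((↑) ⁻¹' B :
      Set (Metric.sphere (0 : EuclideanSpace ℝ (Fin (n + 1))) 1)) :
      Set (EuclideanSpace ℝ (Fin (n + 1))))) := by
    have : (Ioo (0 : ℝ) 1 • ((↑) '' ((↑) ⁻¹' B :
      Set (Metric.sphere (0 : EuclideanSpace ℝ (Fin (n + 1))) 1)) :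
      Set (EuclideanSpace ℝ (Fin (n + 1))))) = {0}ᶜ ∩ ({v | ‖v‖ < 1} ∩
        (fun v => ‖v‖⁻¹ • v) ⁻¹' B) := by
      ext v
      rw [hAB]
      rfl
    rw [this]
    refine (measurableSet_singleton 0).compl.inter
      ((measurableSet_lt measurable_norm measurable_const).inter ?_)
    exact (measurable_norm.inv.smul measurable_id) hB
  rw [Measure.toSphere_apply' _ (measurable_subtype_coe hB), volume_eq_lintegral_consVec hA,
    lintegral_eq_lintegral_Ioi_add_neg, mul_add, ← lintegral_halfCone hB hA hAB (ε := 1) (by simp),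
    ← lintegral_halfCone hB hA hAB (ε := -1) (by simp)]
  · simp
  · refine Measurable.lintegral_prod_right' (f := fun p : ℝ × (Fin n → ℝ) =>
      (Ioo (0 : ℝ) 1 • ((↑) '' ((↑) ⁻¹' B :
      Set (Metric.sphere (0 : EuclideanSpace ℝ (Fin (n + 1))) 1)) :
      Set (EuclideanSpace ℝ (Fin (n + 1))))).indicator 1 (consVec p.1 p.2)) ?_
    exact (measurable_one.indicator hA).comp continuous_consVec.measurable

end Measure

/-! ### Integration and differentiation over the sphere of radius `r`. -/

section SurfaceIntegral

open scoped ENNReal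
open Set

variable {n : ℕ}

/-- The surface measure of the unit sphere as a sum of two measures carried by the open
hemispheres, each parametrized by the gnomonic projection. -/
lemma map_coe_toSphere_eq :
    ((volume : Measure (EuclideanSpace ℝ (Fin (n + 1)))).toSphere).map (↑) =
      ((volume : Measure (Fin n → ℝ)).withDensity
        fun y => ENNReal.ofReal (gnomonicScale 1 y ^ (n + 1))).map
          (fun y => gnomonicScale 1 y • consVec 1 y) +
      ((volume : Measure (Fin n → ℝ)).withDensity
        fun y => ENNReal.ofReal (gnomonicScale 1 y ^ (n + 1))).map
          (fun y => gnomonicScale 1 y • consVec (-1) y) := by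
  have hd : Measurable fun y : Fin n → ℝ => ENNReal.ofReal (gnomonicScale 1 y ^ (n + 1)) :=
    (Continuous.measurable (by fun_prop)).ennreal_ofReal
  have hm : ∀ ε : ℝ, Measurable fun y : Fin n → ℝ => gnomonicScale 1 y • consVec ε y :=
    fun ε => Continuous.measurable (by fun_prop)
  ext B hB
  have : ∀ ε : ℝ, ((volume : Measure (Fin n → ℝ)).withDensity
        fun y => ENNReal.ofReal (gnomonicScale 1 y ^ (n + 1))).map
          (fun y => gnomonicScale 1 y • consVec ε y) B =
      ∫⁻ y : Fin n → ℝ, ENNReal.ofReal (gnomonicScale 1 y ^ (n + 1)) *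
        B.indicator 1 (gnomonicScale 1 y • consVec ε y) := fun ε => by
    rw [← lintegral_indicator_one hB, lintegral_map (measurable_one.indicator hB) (hm ε)]
    exact lintegral_withDensity_eq_lintegral_mul _ hd ((measurable_one.indicator hB).comp (hm ε))
  rw [Measure.map_apply measurable_subtype_coe hB, toSphere_preimage_eq_lintegral hB,
    Measure.add_apply, this, this]

/-- Integration over the unit sphere scaled by `r`, in terms of the surface measure of the unit
sphere. -/
lemma integral_sphereSurfaceMeasure_eq_toSphere {r : ℝ} (hr : 0 < r)
    {g : EuclideanSpace ℝ (Fin (n + 1)) → ℝ} (hg : Continuous g) :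
    ∫ t, g t ∂(sphereSurfaceMeasure n r) =
      r ^ n * ∫ u : Metric.sphere (0 : EuclideanSpace ℝ (Fin (n + 1))) 1, g (r • (u : _))
        ∂(volume : Measure (EuclideanSpace ℝ (Fin (n + 1)))).toSphere := by
  rw [sphereSurfaceMeasure, integral_smul_measure, integral_map (by fun_prop)
    hg.aestronglyMeasurable, ENNReal.toReal_ofReal (by positivity), smul_eq_mul]

/-- Compactness of the sphere gives integrability for the sum of the two hemisphere measures, hence
for each summand. -/
lemma integrable_gnomonic {ε : ℝ} (hε : ε = 1 ∨ ε = -1)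
    {g : EuclideanSpace ℝ (Fin (n + 1)) → ℝ} (hg : Continuous g) :
    Integrable g (((volume : Measure (Fin n → ℝ)).withDensity
        fun y => ENNReal.ofReal (gnomonicScale 1 y ^ (n + 1))).map
          (fun y => gnomonicScale 1 y • consVec ε y)) := by
  have hc : Integrable g
      (((volume : Measure (EuclideanSpace ℝ (Fin (n + 1)))).toSphere).map (↑)) := by
    rw [integrable_map_measure hg.aestronglyMeasurable (by fun_prop)]
    exact (hg.comp continuous_subtype_val).integrable_of_hasCompactSupport
      (HasCompactSupport.of_compactSpace _)
  rw [map_coe_toSphere_eq] at hc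
  rcases hε with rfl | rfl
  · exact hc.left_of_add_measure
  · exact hc.right_of_add_measure

/-- The substitution `z = r • y` passes to the tangent hyperplane at `(ε r, 0)`; its Jacobian
cancels `r^n`. -/
lemma integral_gnomonic {r : ℝ} (hr : 0 < r) (ε : ℝ)
    {g : EuclideanSpace ℝ (Fin (n + 1)) → ℝ} (hg : Continuous g) :
    r ^ n * ∫ u, g (r • u) ∂(((volume : Measure (Fin n → ℝ)).withDensity
        fun y => ENNReal.ofReal (gnomonicScale 1 y ^ (n + 1))).map
          (fun y => gnomonicScale 1 y • consVec ε y)) =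
      ∫ z : Fin n → ℝ, gnomonicScale r z ^ (n + 1) *
        g (consVec (ε * (gnomonicScale r z * r)) (gnomonicScale r z • z)) := by
  have hd : Measurable fun y : Fin n → ℝ => ENNReal.ofReal (gnomonicScale 1 y ^ (n + 1)) :=
    (Continuous.measurable (by fun_prop)).ennreal_ofReal
  rw [integral_map (Continuous.aemeasurable (by fun_prop))
    (Continuous.aestronglyMeasurable (by fun_prop)),
    integral_withDensity_eq_integral_toReal_smul hd (by simp)]
  have h := Measure.integral_comp_smul_of_nonneg (volume : Measure (Fin n → ℝ))
    (fun y : Fin n → ℝ => (ENNReal.ofReal (gnomonicScale 1 y ^ (n + 1))).toReal •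
      g (r • gnomonicScale 1 y • consVec ε y)) r⁻¹ (hR := by positivity)
  have h' : ∫ y : Fin n → ℝ, (ENNReal.ofReal (gnomonicScale 1 y ^ (n + 1))).toReal •
      g (r • gnomonicScale 1 y • consVec ε y) = (r⁻¹ ^ n) * ∫ y : Fin n → ℝ,
      (ENNReal.ofReal (gnomonicScale 1 (r⁻¹ • y) ^ (n + 1))).toReal •
      g (r • gnomonicScale 1 (r⁻¹ • y) • consVec ε (r⁻¹ • y)) := by
    rw [h]
    simp [hr.ne']
  rw [h', ← mul_assoc, ← mul_pow, mul_inv_cancel₀ hr.ne', one_pow, one_mul]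
  refine integral_congr_ae (Filter.Eventually.of_forall fun z => ?_)
  have hk := gnomonicScale_pos r z
  simp only [gnomonicScale_one_inv_smul, smul_eq_mul]
  rw [ENNReal.toReal_ofReal (by positivity), smul_smul, smul_consVec, smul_smul]
  congr 3
  · ring
  · congr 1
    field_simp

/-- Integration over the sphere of radius `r` in gnomonic coordinates. -/
lemma integral_sphereSurfaceMeasure {r : ℝ} (hr : 0 < r)
    {g : EuclideanSpace ℝ (Fin (n + 1)) → ℝ} (hg : Continuous g) :
    ∫ t, g t ∂(sphereSurfaceMeasure n r) =
      (∫ z : Fin n → ℝ, gnomonicScale r z ^ (n + 1) *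
        g (consVec (1 * (gnomonicScale r z * r)) (gnomonicScale r z • z))) +
      ∫ z : Fin n → ℝ, gnomonicScale r z ^ (n + 1) *
        g (consVec (-1 * (gnomonicScale r z * r)) (gnomonicScale r z • z)) := by
  have hg' : Continuous fun u => g (r • u) := by fun_prop
  rw [integral_sphereSurfaceMeasure_eq_toSphere hr hg,
    ← integral_map (φ := Subtype.val) (f := fun u => g (r • u)) (by fun_prop)
      hg'.aestronglyMeasurable, map_coe_toSphere_eq,
    integral_add_measure (integrable_gnomonic (.inl rfl) hg')
      (integrable_gnomonic (.inr rfl) hg'), mul_add, integral_gnomonic hr _ hg,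
      integral_gnomonic hr _ hg]

lemma integrable_sphereSurfaceMeasure (r : ℝ)
    {g : EuclideanSpace ℝ (Fin (n + 1)) → ℝ} (hg : Continuous g) :
    Integrable g (sphereSurfaceMeasure n r) := by
  refine Integrable.smul_measure ?_ (by simp)
  rw [integrable_map_measure hg.aestronglyMeasurable (by fun_prop)]
  exact Continuous.integrable_of_hasCompactSupport (by fun_prop)
    (HasCompactSupport.of_compactSpace _)

instance isFiniteMeasure_sphereSurfaceMeasure (r : ℝ) :
    IsFiniteMeasure (sphereSurfaceMeasure n r) :=
  integrable_const_iff_isFiniteMeasure (one_ne_zero (α := ℝ)) |>.1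
    (integrable_sphereSurfaceMeasure r continuous_const)

lemma ae_norm_eq_sphereSurfaceMeasure {r : ℝ} (hr : 0 < r) :
    ∀ᵐ t ∂(sphereSurfaceMeasure n r), ‖t‖ = r := by
  refine Measure.ae_smul_measure ?_ _
  rw [ae_map_iff (by fun_prop) (measurableSet_eq_fun (by fun_prop) (by fun_prop))]
  refine Filter.Eventually.of_forall fun u => ?_
  simp [norm_smul, abs_of_pos hr]

/-- Differentiation of an exponential family under the integral over the sphere. -/
lemma hasDerivAt_integral_exp_sphereSurfaceMeasure {r : ℝ} (hr : 0 < r)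
    {c d : EuclideanSpace ℝ (Fin (n + 1)) → ℝ} (hc : Continuous c) (hd : Continuous d) (x₀ : ℝ) :
    HasDerivAt (fun x => ∫ t, Real.exp (x * c t + d t) ∂(sphereSurfaceMeasure n r))
      (∫ t, c t * Real.exp (x₀ * c t + d t) ∂(sphereSurfaceMeasure n r)) x₀ := by
  -- The measure lives on the ambient space but is carried by the sphere, so a bound on this compact
  -- product suffices almost everywhere.
  have hcomp : IsCompact (Metric.closedBall x₀ 1 ×ˢ
      Metric.sphere (0 : EuclideanSpace ℝ (Fin (n + 1))) r) :=
    (isCompact_closedBall _ _).prod (isCompact_sphere _ _)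
  obtain ⟨K, hK⟩ := hcomp.exists_bound_of_continuousOn
    (f := fun p : ℝ × EuclideanSpace ℝ (Fin (n + 1)) => c p.2 * Real.exp (p.1 * c p.2 + d p.2))
    (Continuous.continuousOn (by fun_prop))
  refine (hasDerivAt_integral_of_dominated_loc_of_deriv_le (bound := fun _ => K)
    (F' := fun x t => c t * Real.exp (x * c t + d t))
    (Metric.closedBall_mem_nhds x₀ one_pos) ?_ ?_ ?_ ?_ (integrable_const K) ?_).2
  · exact Filter.Eventually.of_forall fun x => Continuous.aestronglyMeasurable (by fun_prop)
  · exact integrable_sphereSurfaceMeasure r (by fun_prop)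
  · exact Continuous.aestronglyMeasurable (by fun_prop)
  · filter_upwards [ae_norm_eq_sphereSurfaceMeasure hr] with t ht x hx
    exact hK (x, t) ⟨hx, by simpa using ht⟩
  · refine Filter.Eventually.of_forall fun t x _ => ?_
    have := (((hasDerivAt_id x).mul_const (c t)).add_const (d t)).exp
    simpa [mul_comm] using this

end SurfaceIntegral

/-! ### Gaussian integrals and their first two moments. -/

section GaussianMoments

open ProbabilityTheory

/-- Completing the square identifies the weight as a multiple of the normal density of mean `b /
(2a)` and variance `1 / (2a)`, whose moments are known. -/
lemma exp_quadratic_eq_gaussianPDFReal {a : ℝ} (ha : 0 < a) (b x : ℝ) :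
    Real.exp (-(a * x ^ 2) + b * x) = √(Real.pi / a) * Real.exp (b ^ 2 / (4 * a)) *
      gaussianPDFReal (b / (2 * a)) (Real.toNNReal (1 / (2 * a))) x := by
  have hv : ((Real.toNNReal (1 / (2 * a)) : NNReal) : ℝ) = 1 / (2 * a) :=
    Real.coe_toNNReal _ (by positivity)
  have h1 : 2 * Real.pi * (1 / (2 * a)) = Real.pi / a := by field_simp
  have h2 : 0 < √(Real.pi / a) := Real.sqrt_pos.2 (by positivity)
  rw [gaussianPDFReal, hv, h1]
  have : √(Real.pi / a) * Real.exp (b ^ 2 / (4 * a)) * ((√(Real.pi / a))⁻¹ *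
      Real.exp (-(x - b / (2 * a)) ^ 2 / (2 * (1 / (2 * a))))) =
      Real.exp (b ^ 2 / (4 * a)) * Real.exp (-(x - b / (2 * a)) ^ 2 / (2 * (1 / (2 * a)))) := by
    field_simp
  rw [this, ← Real.exp_add]
  congr 1
  field_simp
  ring

lemma integral_mul_exp_quadratic {a : ℝ} (ha : 0 < a) (b : ℝ) (h : ℝ → ℝ) :
    ∫ x, h x * Real.exp (-(a * x ^ 2) + b * x) = √(Real.pi / a) * Real.exp (b ^ 2 / (4 * a)) *
      ∫ x, h x ∂gaussianReal (b / (2 * a)) (Real.toNNReal (1 / (2 * a))) := by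
  have hv : Real.toNNReal (1 / (2 * a)) ≠ 0 := by
    rw [Ne, Real.toNNReal_eq_zero, not_le]
    positivity
  rw [integral_gaussianReal_eq_integral_smul hv, ← integral_const_mul]
  refine integral_congr_ae (Filter.Eventually.of_forall fun x => ?_)
  simp only [exp_quadratic_eq_gaussianPDFReal ha, smul_eq_mul]
  ring

lemma integral_exp_quadratic {a : ℝ} (ha : 0 < a) (b : ℝ) :
    ∫ x, Real.exp (-(a * x ^ 2) + b * x) = √(Real.pi / a) * Real.exp (b ^ 2 / (4 * a)) := by
  simpa using integral_mul_exp_quadratic ha b 1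

lemma integral_id_mul_exp_quadratic {a : ℝ} (ha : 0 < a) (b : ℝ) :
    ∫ x, x * Real.exp (-(a * x ^ 2) + b * x) =
      b / (2 * a) * ∫ x, Real.exp (-(a * x ^ 2) + b * x) := by
  rw [integral_exp_quadratic ha, integral_mul_exp_quadratic ha b fun x => x,
    integral_id_gaussianReal, mul_comm]

lemma integral_sq_mul_exp_quadratic {a : ℝ} (ha : 0 < a) (b : ℝ) :
    ∫ x, x ^ 2 * Real.exp (-(a * x ^ 2) + b * x) =
      ((b / (2 * a)) ^ 2 + 1 / (2 * a)) * ∫ x, Real.exp (-(a * x ^ 2) + b * x) := by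
  have hv : ((Real.toNNReal (1 / (2 * a)) : NNReal) : ℝ) = 1 / (2 * a) :=
    Real.coe_toNNReal _ (by positivity)
  have h := variance_id_gaussianReal (μ := b / (2 * a)) (v := Real.toNNReal (1 / (2 * a)))
  rw [variance_eq_sub (memLp_id_gaussianReal 2), hv] at h
  simp only [id, Pi.pow_apply, integral_id_gaussianReal] at h
  rw [integral_exp_quadratic ha, integral_mul_exp_quadratic ha b fun x => x ^ 2, mul_comm]
  congr 1
  linarith

variable {n : ℕ}

lemma exp_sum_quadratic_eq_prod (a b z : Fin n → ℝ) :
    Real.exp (-(∑ i, a i * z i ^ 2) + ∑ i, b i * z i) =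
      ∏ i, Real.exp (-(a i * z i ^ 2) + b i * z i) := by
  rw [← Real.exp_sum, Finset.sum_add_distrib, Finset.sum_neg_distrib]

lemma integral_exp_sum_quadratic {a : Fin n → ℝ} (ha : ∀ i, 0 < a i) (b : Fin n → ℝ) :
    ∫ z : Fin n → ℝ, Real.exp (-(∑ i, a i * z i ^ 2) + ∑ i, b i * z i) =
      Real.pi ^ ((n : ℝ) / 2) / (∏ i, a i ^ (1 / 2 : ℝ)) *
        Real.exp (∑ i, b i ^ 2 / (4 * a i)) := by
  simp only [exp_sum_quadratic_eq_prod]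
  rw [integral_fintype_prod_volume_eq_prod
    (fun i x => Real.exp (-(a i * x ^ 2) + b i * x))]
  simp only [integral_exp_quadratic (ha _), Real.sqrt_div Real.pi_pos.le, Finset.prod_mul_distrib,
    Finset.prod_div_distrib, Real.exp_sum, Real.sqrt_eq_rpow, Finset.prod_const, Finset.card_univ,
    Fintype.card_fin]
  rw [← Real.rpow_mul_natCast Real.pi_pos.le]
  congr 3
  ring

/-- A moment in one coordinate of a product of Gaussian weights is the corresponding
one-dimensional moment. -/
lemma integral_coord_mul_exp_sum_quadratic (a b : Fin n → ℝ) (j : Fin n) {h : ℝ → ℝ} {K : ℝ}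
    (hK : ∫ x, h x * Real.exp (-(a j * x ^ 2) + b j * x) =
      K * ∫ x, Real.exp (-(a j * x ^ 2) + b j * x)) :
    ∫ z : Fin n → ℝ, h (z j) * Real.exp (-(∑ i, a i * z i ^ 2) + ∑ i, b i * z i) =
      K * ∫ z : Fin n → ℝ, Real.exp (-(∑ i, a i * z i ^ 2) + ∑ i, b i * z i) := by
  have h1 : ∀ z : Fin n → ℝ, h (z j) * Real.exp (-(∑ i, a i * z i ^ 2) + ∑ i, b i * z i) =
      ∏ i, ((if i = j then h (z i) else 1) * Real.exp (-(a i * z i ^ 2) + b i * z i)) := by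
    intro z
    rw [exp_sum_quadratic_eq_prod, Finset.prod_mul_distrib]
    simp
  have h2 : ∀ i, ∫ x, (if i = j then h x else 1) * Real.exp (-(a i * x ^ 2) + b i * x) =
      (if i = j then K else 1) * ∫ x, Real.exp (-(a i * x ^ 2) + b i * x) := by
    intro i
    by_cases hij : i = j
    · subst hij
      simpa using hK
    · simp [hij]
  simp only [h1]
  rw [integral_fintype_prod_volume_eq_prod
    (fun i x => (if i = j then h x else 1) * Real.exp (-(a i * x ^ 2) + b i * x))]
  simp only [h2, Finset.prod_mul_distrib, exp_sum_quadratic_eq_prod]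
  rw [integral_fintype_prod_volume_eq_prod
    (fun i x => Real.exp (-(a i * x ^ 2) + b i * x))]
  simp

end GaussianMoments

/-! ### Laplace asymptotics of one hemisphere by dominated convergence. -/

section Laplace

open Filter Topology

variable {n : ℕ}

lemma tendsto_gnomonicScale (z : Fin n → ℝ) :
    Tendsto (fun r : ℝ => gnomonicScale r z) atTop (𝓝 1) := by
  have h : Tendsto (fun r : ℝ => 1 + ∑ i, (z i / r) ^ 2) atTop (𝓝 (1 + ∑ _i : Fin n, 0 ^ 2)) :=
    tendsto_const_nhds.add (tendsto_finsetSum _ fun i _ =>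
      (tendsto_const_nhds.div_atTop tendsto_id).pow 2)
  have h2 := (h.sqrt).inv₀ (by simp)
  simpa [gnomonicScale] using h2

/-- The radial defect `r - σ r` of the projection of a point onto the sphere of radius `r`. -/
lemma tendsto_sub_gnomonicScale_mul (z : Fin n → ℝ) :
    Tendsto (fun r : ℝ => r - gnomonicScale r z * r) atTop (𝓝 0) := by
  set S := ∑ i, z i ^ 2 with hS
  have hS0 : 0 ≤ S := Finset.sum_nonneg fun i _ => sq_nonneg _
  refine squeeze_zero' (g := fun r : ℝ => S / r) ?_ ?_ (tendsto_const_nhds.div_atTop tendsto_id)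
  · filter_upwards [eventually_gt_atTop 0] with r hr
    have := gnomonicScale_le_one r z
    nlinarith
  · filter_upwards [eventually_gt_atTop 0] with r hr
    have h1 := gnomonicScale_le_one r z
    have h0 := gnomonicScale_pos r z
    have h2 := gnomonicScale_sq_mul hr.ne' z
    rw [le_div_iff₀ hr]
    have h3 : gnomonicScale r z ^ 2 ≤ 1 := pow_le_one₀ h0.le h1
    -- `r² (1 - σ) ≤ r² (1 - σ²) = σ² S ≤ S`.
    nlinarith [mul_le_mul_of_nonneg_right h3 hS0, mul_nonneg h0.le (sub_nonneg.2 h1),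
      mul_nonneg (mul_nonneg h0.le (sub_nonneg.2 h1)) (sq_nonneg r)]

/-- `(1 - σ)² ≤ 1 - σ²` for `0 ≤ σ ≤ 1`. The bound lets Gaussian decay control the term linear in
the radial defect, whose coefficient may have either sign. -/
lemma sub_gnomonicScale_mul_bounds {r : ℝ} (hr : 0 < r) (z : Fin n → ℝ) :
    0 ≤ r - gnomonicScale r z * r ∧
      (r - gnomonicScale r z * r) ^ 2 ≤ ∑ i, (gnomonicScale r z * z i) ^ 2 := by
  have h1 := gnomonicScale_le_one r z
  have h0 := gnomonicScale_pos r z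
  have h2 := gnomonicScale_sq_mul hr.ne' z
  refine ⟨by nlinarith, ?_⟩
  simp only [mul_pow, ← Finset.mul_sum]
  nlinarith [mul_nonneg (mul_nonneg h0.le (sub_nonneg.2 h1)) (sq_nonneg r)]

lemma one_add_pow_le_mul_exp {b : ℝ} (hb : 0 < b) (N : ℕ) :
    ∃ K, 0 ≤ K ∧ ∀ T, 0 ≤ T → (1 + T) ^ N ≤ K * Real.exp (b * T) := by
  -- Dividing by `N + 1` rather than `N` covers `N = 0`.
  set c := b / (N + 1) with hc
  have hc0 : 0 < c := by positivity
  refine ⟨(1 + c⁻¹) ^ N, by positivity, fun T hT => ?_⟩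
  have h1 : 1 + T ≤ (1 + c⁻¹) * Real.exp (c * T) := by
    have := Real.add_one_le_exp (c * T)
    have h2 : (1 + c⁻¹) * (c * T + 1) = 1 + T + c * T + c⁻¹ := by
      field_simp
      ring
    have h3 : (1 + c⁻¹) * (c * T + 1) ≤ (1 + c⁻¹) * Real.exp (c * T) := by gcongr
    have : 0 ≤ c * T := by positivity
    have : 0 ≤ c⁻¹ := by positivity
    linarith
  calc (1 + T) ^ N ≤ ((1 + c⁻¹) * Real.exp (c * T)) ^ N := by gcongr
    _ = (1 + c⁻¹) ^ N * Real.exp (N * (c * T)) := by rw [mul_pow, Real.exp_nat_mul]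
    _ ≤ (1 + c⁻¹) ^ N * Real.exp (b * T) := by
      have h2 : N * c ≤ b := by
        rw [hc, mul_div_assoc', div_le_iff₀ (by positivity)]
        nlinarith
      rw [← mul_assoc]
      gcongr

/-- Gaussian decay beats a polynomial and a linear exponential. -/
lemma exp_neg_quadratic_mul_pow_bound {a : Fin n → ℝ} (ha : ∀ i, 0 < a i) (b : Fin n → ℝ) (c : ℝ)
    (N : ℕ) :
    ∃ K, 0 ≤ K ∧ ∀ (t : Fin n → ℝ) (δ : ℝ), 0 ≤ δ → δ ^ 2 ≤ ∑ i, t i ^ 2 →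
      (1 + ∑ i, t i ^ 2) ^ N *
        Real.exp (-(∑ i, a i * t i ^ 2) + ∑ i, b i * t i + c * δ) ≤ K := by
  obtain ⟨α, hα, hαa⟩ : ∃ α > 0, ∀ i, α ≤ a i := by
    rcases isEmpty_or_nonempty (Fin n) with h | h
    · exact ⟨1, one_pos, fun i => h.elim i⟩
    · obtain ⟨i, hi⟩ := Finite.exists_min a
      exact ⟨a i, ha i, hi⟩
  obtain ⟨K, hK0, hK⟩ := one_add_pow_le_mul_exp (b := α / 2) (by positivity) N
  refine ⟨K * Real.exp (∑ i, b i ^ 2 / α + c ^ 2 / α), by positivity, fun t δ hδ hδt => ?_⟩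
  set T := ∑ i, t i ^ 2 with hT
  have hT0 : 0 ≤ T := Finset.sum_nonneg fun i _ => sq_nonneg _
  -- The linear term and the `δ` term each cost `α/4 * T` of the decay `α * T`; the remaining `α/2 *
  -- T` absorbs the polynomial.
  have young : ∀ x y : ℝ, x * y ≤ x ^ 2 / α + α / 4 * y ^ 2 := fun x y => by
    have : x ^ 2 / α + α / 4 * y ^ 2 - x * y = (x - α / 2 * y) ^ 2 / α := by
      field_simp
      ring
    have h2 : 0 ≤ (x - α / 2 * y) ^ 2 / α := by positivity
    linarith
  have h1 : α * T ≤ ∑ i, a i * t i ^ 2 := by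
    rw [hT, Finset.mul_sum]
    gcongr with i
    exact hαa i
  have h2 : ∑ i, b i * t i ≤ ∑ i, b i ^ 2 / α + α / 4 * T := by
    rw [hT, Finset.mul_sum, ← Finset.sum_add_distrib]
    exact Finset.sum_le_sum fun i _ => young _ _
  have h3 : c * δ ≤ c ^ 2 / α + α / 4 * T := (young c δ).trans (by gcongr)
  calc (1 + T) ^ N * Real.exp (-(∑ i, a i * t i ^ 2) + ∑ i, b i * t i + c * δ)
      ≤ (K * Real.exp (α / 2 * T)) *
        Real.exp (-(α / 2 * T) + (∑ i, b i ^ 2 / α + c ^ 2 / α)) := by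
        refine mul_le_mul (hK T hT0) (Real.exp_le_exp.2 ?_) (Real.exp_pos _).le (by positivity)
        linarith
    _ = K * Real.exp (∑ i, b i ^ 2 / α + c ^ 2 / α) := by
        rw [mul_assoc, ← Real.exp_add]
        congr 2
        ring

/-- Integrable because the exponent `n + 1` exceeds the dimension `n`. -/
lemma integrable_inv_sqrt_one_add_norm_sq_pow :
    Integrable fun z : Fin n → ℝ => (√(1 + ‖z‖ ^ 2))⁻¹ ^ (n + 1) := by
  have h := integrable_rpow_neg_one_add_norm_sq (E := Fin n → ℝ) (μ := volume)
    (r := (n : ℝ) + 1) (by simp)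
  refine h.congr (Eventually.of_forall fun z => ?_)
  have h0 : 0 < 1 + ‖z‖ ^ 2 := by positivity
  simp only
  rw [Real.sqrt_eq_rpow, ← Real.rpow_neg h0.le, ← Real.rpow_mul_natCast h0.le]
  congr 1
  push_cast
  ring

/-- `σ² (1 + ‖z‖²) ≤ 1 + T ≤ (1 + T)²`, where the sup norm satisfies `‖z‖² ≤ ∑ z_i²`. The last
factor is independent of `r`, as a majorant requires. -/
lemma gnomonicScale_le_mul {r : ℝ} (z : Fin n → ℝ) :
    gnomonicScale r z ≤ (1 + ∑ i, (gnomonicScale r z * z i) ^ 2) * (√(1 + ‖z‖ ^ 2))⁻¹ := by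
  have h1 := gnomonicScale_le_one r z
  have h0 := gnomonicScale_pos r z
  set σ := gnomonicScale r z
  set T := ∑ i, (σ * z i) ^ 2 with hT
  have hT0 : 0 ≤ T := Finset.sum_nonneg fun i _ => sq_nonneg _
  have hz : ‖z‖ ^ 2 ≤ ∑ i, z i ^ 2 := by
    have hS0 : 0 ≤ ∑ i, z i ^ 2 := Finset.sum_nonneg fun i _ => sq_nonneg _
    rw [← Real.le_sqrt (norm_nonneg _) hS0, pi_norm_le_iff_of_nonneg (Real.sqrt_nonneg _)]
    intro i
    refine Real.le_sqrt_of_sq_le ?_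
    rw [Real.norm_eq_abs, sq_abs]
    exact Finset.single_le_sum (f := fun i => z i ^ 2) (fun i _ => sq_nonneg _) (Finset.mem_univ i)
  have hTS : T = σ ^ 2 * ∑ i, z i ^ 2 := by simp [hT, mul_pow, Finset.mul_sum]
  rw [← div_eq_mul_inv, le_div_iff₀ (Real.sqrt_pos.2 (by positivity))]
  refine le_of_sq_le_sq ?_ (by positivity)
  rw [mul_pow, Real.sq_sqrt (by positivity)]
  have h3 : σ ^ 2 ≤ 1 := pow_le_one₀ h0.le h1
  nlinarith [mul_le_mul_of_nonneg_left hz (sq_nonneg σ)]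

/-- Laplace asymptotics of a hemisphere integral in gnomonic coordinates. -/
lemma tendsto_integral_gnomonic {a : Fin n → ℝ} (ha : ∀ i, 0 < a i) (b : Fin n → ℝ) (c : ℝ)
    {p : ℝ → (Fin n → ℝ) → ℝ} {q : (Fin n → ℝ) → ℝ} (hp : ∀ r, Continuous (p r))
    (hbound : ∀ r, 0 < r → ∀ z, |p r z| ≤ 1 + ∑ i, (gnomonicScale r z * z i) ^ 2)
    (hlim : ∀ z, Tendsto (fun r => p r z) atTop (𝓝 (q z))) :
    Tendsto (fun r => ∫ z : Fin n → ℝ, gnomonicScale r z ^ (n + 1) * (p r z *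
        Real.exp (-(∑ i, a i * (gnomonicScale r z * z i) ^ 2) +
          ∑ i, b i * (gnomonicScale r z * z i) + c * (r - gnomonicScale r z * r)))) atTop
      (𝓝 (∫ z : Fin n → ℝ, q z * Real.exp (-(∑ i, a i * z i ^ 2) + ∑ i, b i * z i))) := by
  -- Of the `n + 2` powers of `1 + T`, `n + 1` come from `σ^(n+1)` and one from the bound on `p`.
  obtain ⟨K, hK0, hK⟩ := exp_neg_quadratic_mul_pow_bound ha b c (n + 2)
  refine tendsto_integral_filter_of_dominated_convergence
    (fun z => K * (√(1 + ‖z‖ ^ 2))⁻¹ ^ (n + 1)) ?_ ?_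
    (integrable_inv_sqrt_one_add_norm_sq_pow.const_mul K) ?_
  · refine Eventually.of_forall fun r => Continuous.aestronglyMeasurable ?_
    have := hp r
    fun_prop
  · filter_upwards [eventually_gt_atTop 0] with r hr
    refine Eventually.of_forall fun z => ?_
    have h0 := gnomonicScale_pos r z
    obtain ⟨hδ, hδ2⟩ := sub_gnomonicScale_mul_bounds hr z
    have h1 := hK _ _ hδ hδ2
    have hb := hbound r hr z
    have hs := gnomonicScale_le_mul (r := r) z
    set T := ∑ i, (gnomonicScale r z * z i) ^ 2 with hT
    have hT0 : 0 ≤ T := Finset.sum_nonneg fun i _ => sq_nonneg _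
    rw [norm_mul, norm_mul, Real.norm_of_nonneg (Real.exp_pos _).le,
      Real.norm_of_nonneg (by positivity), Real.norm_eq_abs]
    refine (mul_le_mul (pow_le_pow_left₀ h0.le hs (n + 1))
      (mul_le_mul_of_nonneg_right hb (Real.exp_pos _).le) (by positivity)
      (by positivity)).trans ?_
    refine le_trans (le_of_eq ?_) (mul_le_mul_of_nonneg_right h1 (by positivity))
    rw [mul_pow]
    generalize Real.exp _ = x
    ring
  · refine Eventually.of_forall fun z => ?_
    have hσ := tendsto_gnomonicScale z
    have hδ := tendsto_sub_gnomonicScale_mul z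
    have hexp : Tendsto (fun r => -(∑ i, a i * (gnomonicScale r z * z i) ^ 2) +
        ∑ i, b i * (gnomonicScale r z * z i) + c * (r - gnomonicScale r z * r)) atTop
        (𝓝 (-(∑ i, a i * (1 * z i) ^ 2) + ∑ i, b i * (1 * z i) + c * 0)) := by
      refine (Tendsto.add (Tendsto.neg ?_) ?_).add (hδ.const_mul c)
      · exact tendsto_finsetSum _ fun i _ => ((hσ.mul_const _).pow 2).const_mul _
      · exact tendsto_finsetSum _ fun i _ => (hσ.mul_const _).const_mul _
    have := (hσ.pow (n + 1)).mul ((hlim z).mul ((Real.continuous_exp.tendsto _).comp hexp))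
    simpa using this

end Laplace

/-! ### Derivatives as moments, and moments as sums over hemispheres. -/

section Moments

open Filter Topology

variable {n : ℕ}

/-- The hemisphere integral of a weight `p` against the Fisher–Bingham density, in gnomonic
coordinates and divided by the value of the density at the pole `(ε r, 0)`. -/
noncomputable def hemisphereIntegral (lam tau : Fin (n + 1) → ℝ) (p : ℝ → (Fin n → ℝ) → ℝ)
    (ε r : ℝ) : ℝ :=
  ∫ z : Fin n → ℝ, gnomonicScale r z ^ (n + 1) * (p r z *
    Real.exp (-(∑ i : Fin n, (lam 0 - lam i.succ) * (gnomonicScale r z * z i) ^ 2) +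
      ∑ i : Fin n, tau i.succ * (gnomonicScale r z * z i) +
      -(ε * tau 0) * (r - gnomonicScale r z * r)))

/-- The Gaussian integral which is the limit of `hemisphereIntegral`. -/
noncomputable def tangentGaussianIntegral (lam tau : Fin (n + 1) → ℝ) (q : (Fin n → ℝ) → ℝ) : ℝ :=
  ∫ z : Fin n → ℝ, q z * Real.exp (-(∑ i : Fin n, (lam 0 - lam i.succ) * z i ^ 2) +
    ∑ i : Fin n, tau i.succ * z i)

lemma tendsto_hemisphereIntegral {lam tau : Fin (n + 1) → ℝ}
    (h_top : ∀ j : Fin n, lam j.succ < lam 0)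
    {p : ℝ → (Fin n → ℝ) → ℝ} {q : (Fin n → ℝ) → ℝ} (hp : ∀ r, Continuous (p r))
    (hbound : ∀ r, 0 < r → ∀ z, |p r z| ≤ 1 + ∑ i, (gnomonicScale r z * z i) ^ 2)
    (hlim : ∀ z, Tendsto (fun r => p r z) atTop (𝓝 (q z))) (ε : ℝ) :
    Tendsto (hemisphereIntegral lam tau p ε) atTop (𝓝 (tangentGaussianIntegral lam tau q)) :=
  tendsto_integral_gnomonic (fun i => sub_pos.2 (h_top i)) _ _ hp hbound hlim

/-- The sphere equation eliminates `t_0²`, and `ε σ r = ε r - ε (r - σ r)`; the value at the pole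
splits off. -/
lemma exponent_consVec {lam tau : Fin (n + 1) → ℝ} {r ε : ℝ} (hr : 0 < r) (hε : ε ^ 2 = 1)
    (z : Fin n → ℝ) :
    (∑ i, lam i * consVec (ε * (gnomonicScale r z * r)) (gnomonicScale r z • z) i ^ 2 +
      ∑ i, tau i * consVec (ε * (gnomonicScale r z * r)) (gnomonicScale r z • z) i) =
    r ^ 2 * lam 0 + ε * (r * tau 0) +
      (-(∑ i : Fin n, (lam 0 - lam i.succ) * (gnomonicScale r z * z i) ^ 2) +
      ∑ i : Fin n, tau i.succ * (gnomonicScale r z * z i) +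
      -(ε * tau 0) * (r - gnomonicScale r z * r)) := by
  have h := gnomonicScale_sq_mul hr.ne' z
  have h2 : ∑ i : Fin n, (lam 0 - lam i.succ) * (gnomonicScale r z * z i) ^ 2 =
      lam 0 * (gnomonicScale r z ^ 2 * ∑ i, z i ^ 2) -
        ∑ i : Fin n, lam i.succ * (gnomonicScale r z * z i) ^ 2 := by
    rw [Finset.mul_sum, Finset.mul_sum, ← Finset.sum_sub_distrib]
    exact Finset.sum_congr rfl fun i _ => by ring
  simp only [Fin.sum_univ_succ, consVec_zero, consVec_succ, Pi.smul_apply, smul_eq_mul, h2]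
  linear_combination lam 0 * h + lam 0 * (gnomonicScale r z * r) ^ 2 * hε

/-- A moment of the Fisher–Bingham density as a sum over the two hemispheres. -/
lemma integral_mul_exp_sphereSurfaceMeasure (lam tau : Fin (n + 1) → ℝ) {r : ℝ} (hr : 0 < r)
    {w : EuclideanSpace ℝ (Fin (n + 1)) → ℝ} (hw : Continuous w) {p : ℝ → (Fin n → ℝ) → ℝ}
    {k l : ℝ}
    (hk : ∀ z, w (consVec (1 * (gnomonicScale r z * r)) (gnomonicScale r z • z)) = k * p r z)
    (hl : ∀ z, w (consVec (-1 * (gnomonicScale r z * r)) (gnomonicScale r z • z)) = l * p r z) :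
    ∫ t, w t * Real.exp (∑ i, lam i * t i ^ 2 + ∑ i, tau i * t i) ∂(sphereSurfaceMeasure n r) =
      Real.exp (r ^ 2 * lam 0) *
        (Real.exp (r * tau 0) * (k * hemisphereIntegral lam tau p 1 r) +
          Real.exp (-(r * tau 0)) * (l * hemisphereIntegral lam tau p (-1) r)) := by
  have key : ∀ ε m : ℝ, ε ^ 2 = 1 →
      (∀ z, w (consVec (ε * (gnomonicScale r z * r)) (gnomonicScale r z • z)) = m * p r z) →
      ∫ z : Fin n → ℝ, gnomonicScale r z ^ (n + 1) *
        (w (consVec (ε * (gnomonicScale r z * r)) (gnomonicScale r z • z)) * Real.exp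
        (∑ i, lam i * consVec (ε * (gnomonicScale r z * r)) (gnomonicScale r z • z) i ^ 2 +
        ∑ i, tau i * consVec (ε * (gnomonicScale r z * r)) (gnomonicScale r z • z) i)) =
      Real.exp (r ^ 2 * lam 0) * (Real.exp (ε * (r * tau 0)) *
        (m * hemisphereIntegral lam tau p ε r)) := by
    intro ε m hε hm
    simp only [hemisphereIntegral, ← integral_const_mul]
    refine integral_congr_ae (Eventually.of_forall fun z => ?_)
    simp only
    rw [exponent_consVec hr hε, Real.exp_add, Real.exp_add, hm]
    ring
  rw [integral_sphereSurfaceMeasure hr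
    (g := fun t => w t * Real.exp (∑ i, lam i * t i ^ 2 + ∑ i, tau i * t i)) (by fun_prop),
    key 1 k (by norm_num) hk, key (-1) l (by norm_num) hl, mul_add]
  simp only [one_mul, neg_one_mul]

/-- Exhibits the exponent as affine in the varied parameter, as
`hasDerivAt_integral_exp_sphereSurfaceMeasure` requires. -/
lemma sum_update_mul {ι : Type*} [Fintype ι] [DecidableEq ι] (f g : ι → ℝ) (j : ι) (x : ℝ) :
    ∑ i, Function.update f j x i * g i = x * g j + (∑ i, f i * g i - f j * g j) := by
  rw [← Finset.add_sum_erase _ _ (Finset.mem_univ j),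
    ← Finset.add_sum_erase _ (fun i => f i * g i) (Finset.mem_univ j)]
  have : ∑ i ∈ Finset.univ.erase j, Function.update f j x i * g i =
      ∑ i ∈ Finset.univ.erase j, f i * g i :=
    Finset.sum_congr rfl fun i hi => by rw [Function.update_of_ne (Finset.ne_of_mem_erase hi)]
  rw [this, Function.update_self]
  ring

lemma hasDerivAt_fisherBingham_lam (lam tau : Fin (n + 1) → ℝ) {r : ℝ} (hr : 0 < r)
    (j : Fin (n + 1)) :
    HasDerivAt (fun x => fisherBingham (Function.update lam j x) tau r)
      (∫ t, t j ^ 2 * Real.exp (∑ i, lam i * t i ^ 2 + ∑ i, tau i * t i)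
        ∂(sphereSurfaceMeasure n r)) (lam j) := by
  have h := hasDerivAt_integral_exp_sphereSurfaceMeasure (n := n) hr (c := fun t => t j ^ 2)
    (d := fun t => ∑ i, lam i * t i ^ 2 - lam j * t j ^ 2 + ∑ i, tau i * t i) (by fun_prop)
    (by fun_prop) (lam j)
  convert h using 4 with x t t
  · exact integral_congr_ae (Eventually.of_forall fun t => by simp [sum_update_mul, add_assoc])
  · congr 1
    ring

lemma hasDerivAt_fisherBingham_tau (lam tau : Fin (n + 1) → ℝ) {r : ℝ} (hr : 0 < r)
    (j : Fin (n + 1)) :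
    HasDerivAt (fun x => fisherBingham lam (Function.update tau j x) r)
      (∫ t, t j * Real.exp (∑ i, lam i * t i ^ 2 + ∑ i, tau i * t i)
        ∂(sphereSurfaceMeasure n r)) (tau j) := by
  have h := hasDerivAt_integral_exp_sphereSurfaceMeasure (n := n) hr (c := fun t => t j)
    (d := fun t => ∑ i, tau i * t i - tau j * t j + ∑ i, lam i * t i ^ 2) (by fun_prop)
    (by fun_prop) (tau j)
  convert h using 4 with x t t
  · refine integral_congr_ae (Eventually.of_forall fun t => ?_)
    simp only [sum_update_mul]
    congr 1
    ring
  · congr 1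
    ring

/-- A first moment in a tangential direction vanishes when the density is even in it. -/
lemma hemisphereIntegral_coord_eq_zero (lam : Fin (n + 1) → ℝ) {tau : Fin (n + 1) → ℝ} {j : Fin n}
    (hj : tau j.succ = 0) (ε r : ℝ) :
    hemisphereIntegral lam tau (fun r z => gnomonicScale r z * z j) ε r = 0 := by
  -- Reflection in the `j`-th coordinate preserves volume and, as `tau j.succ = 0`, everything in
  -- the integrand except the sign of `z j`.
  set R : (Fin n → ℝ) → Fin n → ℝ := fun z i => (if i = j then -1 else 1 : ℝ) * z i with hR
  have hRmp : MeasurePreserving R := by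
    refine volume_preserving_pi (f := fun i x => (if i = j then -1 else 1 : ℝ) * x) fun i => ?_
    by_cases h : i = j
    · simpa [h] using Measure.measurePreserving_neg (volume : Measure ℝ)
    · simp only [h, if_false, one_mul]
      exact MeasurePreserving.id _
  have hsq : ∀ i : Fin n, (if i = j then -1 else 1 : ℝ) ^ 2 = 1 := fun i => by
    split_ifs <;> norm_num
  have hσ : ∀ z, gnomonicScale r (R z) = gnomonicScale r z := fun z => by
    simp only [gnomonicScale, hR, mul_div_assoc, mul_pow, hsq, one_mul]
  have htau : ∀ i : Fin n, tau i.succ * (if i = j then -1 else 1 : ℝ) = tau i.succ := fun i => by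
    by_cases h : i = j
    · simp [h, hj]
    · simp [h]
  rw [← self_eq_neg]
  conv_lhs => rw [hemisphereIntegral, ← hRmp.map_eq]
  rw [integral_map hRmp.measurable.aemeasurable
    (Continuous.aestronglyMeasurable (by fun_prop)), hemisphereIntegral, ← integral_neg]
  refine integral_congr_ae (Eventually.of_forall fun z => ?_)
  have h1 : ∀ i, tau i.succ * (gnomonicScale r z * R z i) =
      tau i.succ * (gnomonicScale r z * z i) := fun i => by
    simp only [hR]
    linear_combination gnomonicScale r z * z i * htau i
  have h2 : ∀ i, (gnomonicScale r z * R z i) ^ 2 = (gnomonicScale r z * z i) ^ 2 := fun i => by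
    simp only [hR]
    linear_combination gnomonicScale r z ^ 2 * z i ^ 2 * hsq i
  have h3 : R z j = -z j := by simp [hR]
  simp only [hσ, h1, h2, h3]
  ring

end Moments

/-! ### Combining two hemispheres with a common limit. -/

section Asymptotics

open Filter Topology Asymptotics

/-- A convex combination is within `|G - L| + |H - L|` of `L`, so the weights need not converge. -/
lemma tendsto_weighted_average {ι : Type*} {l : Filter ι} {A B G H : ι → ℝ} {L : ℝ}
    (hA : ∀ x, 0 < A x) (hB : ∀ x, 0 < B x) (hG : Tendsto G l (𝓝 L)) (hH : Tendsto H l (𝓝 L)) :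
    Tendsto (fun x => (A x * G x + B x * H x) / (A x + B x)) l (𝓝 L) := by
  have h1 : Tendsto (fun x => |G x - L| + |H x - L|) l (𝓝 0) := by
    simpa using (hG.sub_const L).abs.add (hH.sub_const L).abs
  rw [tendsto_iff_norm_sub_tendsto_zero]
  refine squeeze_zero (fun x => norm_nonneg _) (fun x => ?_) h1
  have hAx := hA x
  have hBx := hB x
  have h2 : (A x * G x + B x * H x) / (A x + B x) - L =
      A x / (A x + B x) * (G x - L) + B x / (A x + B x) * (H x - L) := by
    field_simp
    ring
  rw [h2]
  refine (norm_add_le _ _).trans ?_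
  simp only [norm_mul, Real.norm_eq_abs]
  gcongr
  · refine mul_le_of_le_one_left (abs_nonneg _) ?_
    rw [abs_of_pos (by positivity), div_le_one (by positivity)]
    linarith
  · refine mul_le_of_le_one_left (abs_nonneg _) ?_
    rw [abs_of_pos (by positivity), div_le_one (by positivity)]
    linarith

lemma isEquivalent_of_tendsto_div {ι : Type*} {l : Filter ι} {u v D : ι → ℝ} {L : ℝ} (hL : L ≠ 0)
    (hD : ∀ᶠ x in l, D x ≠ 0) (hu : Tendsto (fun x => u x / D x) l (𝓝 L))
    (hv : Tendsto (fun x => v x / D x) l (𝓝 L)) : u ~[l] v := by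
  have hv0 : ∀ᶠ x in l, v x ≠ 0 := by
    filter_upwards [hv.eventually_ne hL] with x hx h
    simp [h] at hx
  rw [isEquivalent_iff_tendsto_one hv0]
  have := hu.div hv hL
  rw [div_self hL] at this
  refine this.congr' ?_
  filter_upwards [hD] with x hx
  simp [div_div_div_cancel_right₀ hx]

/-- The expression is `m * G - (m - 1) * H` with `m = (1 - exp (-2cr))⁻¹`. This is not a convex
combination, but `m` converges since `c ≠ 0`: to `1` if `c > 0`, to `0` if `c < 0`. -/
lemma tendsto_weighted_difference {c L : ℝ} (hc : c ≠ 0) {G H : ℝ → ℝ}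
    (hG : Tendsto G atTop (𝓝 L)) (hH : Tendsto H atTop (𝓝 L)) :
    Tendsto (fun r => (Real.exp (r * c) * G r - Real.exp (-(r * c)) * H r) /
      (Real.exp (r * c) - Real.exp (-(r * c)))) atTop (𝓝 L) := by
  obtain ⟨m, hm⟩ : ∃ m, Tendsto (fun r : ℝ => (1 - Real.exp (-(2 * c * r)))⁻¹) atTop (𝓝 m) := by
    rcases hc.lt_or_gt with h | h
    · refine ⟨0, tendsto_inv_atBot_zero.comp ?_⟩
      refine tendsto_atBot_add_const_left _ 1 (tendsto_neg_atTop_atBot.comp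
        (Real.tendsto_exp_atTop.comp ?_))
      refine (tendsto_id.const_mul_atTop (r := -(2 * c)) (by linarith)).congr fun r => ?_
      simp
    · refine ⟨(1 - 0)⁻¹, Tendsto.inv₀ (tendsto_const_nhds.sub ?_) (by norm_num)⟩
      refine Real.tendsto_exp_neg_atTop_nhds_zero.comp
        (tendsto_id.const_mul_atTop (r := 2 * c) (by linarith))
  have h := (hm.mul hG).sub ((hm.sub_const 1).mul hH)
  have hL : m * L - (m - 1) * L = L := by ring
  rw [hL] at h
  refine h.congr' ?_
  filter_upwards [eventually_gt_atTop 0] with r hr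
  have hne : Real.exp (r * c) - Real.exp (-(r * c)) ≠ 0 := by
    rw [Ne, sub_eq_zero, Real.exp_eq_exp]
    intro h0
    have : r * c = 0 := by linarith
    simp [hr.ne', hc] at this
  have h1 : Real.exp (-(2 * c * r)) = Real.exp (-(r * c)) / Real.exp (r * c) := by
    rw [← Real.exp_sub]
    congr 1
    ring
  have h2 : 1 - Real.exp (-(2 * c * r)) =
      (Real.exp (r * c) - Real.exp (-(r * c))) / Real.exp (r * c) := by
    rw [h1, sub_div, div_self (Real.exp_pos _).ne']
  rw [h2, inv_div]
  field_simp
  ring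

end Asymptotics

/-! ### The asymptotic formulas. -/

section Main

open Filter Topology Asymptotics

variable {n : ℕ}

/-- The sum of the values of the Fisher–Bingham density at the two poles `(± r, 0)`. -/
noncomputable def poleSum (lam tau : Fin (n + 1) → ℝ) (r : ℝ) : ℝ :=
  Real.exp (r ^ 2 * lam 0) * (Real.exp (r * tau 0) + Real.exp (-(r * tau 0)))

lemma poleSum_pos (lam tau : Fin (n + 1) → ℝ) (r : ℝ) : 0 < poleSum lam tau r := by
  unfold poleSum
  positivity

/-- Asymptotics of the moments whose weight takes the same values on both hemispheres. -/
lemma tendsto_moment_div_poleSum {lam tau : Fin (n + 1) → ℝ}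
    (h_top : ∀ j : Fin n, lam j.succ < lam 0)
    {w : EuclideanSpace ℝ (Fin (n + 1)) → ℝ} (hw : Continuous w)
    {p : ℝ → (Fin n → ℝ) → ℝ} {q : (Fin n → ℝ) → ℝ} (hp : ∀ r, Continuous (p r))
    (hbound : ∀ r, 0 < r → ∀ z, |p r z| ≤ 1 + ∑ i, (gnomonicScale r z * z i) ^ 2)
    (hlim : ∀ z, Tendsto (fun r => p r z) atTop (𝓝 (q z))) {k : ℝ → ℝ} (hk : ∀ r, 0 < r → k r ≠ 0)
    (hwp : ∀ r z ε, ε ^ 2 = 1 →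
      w (consVec (ε * (gnomonicScale r z * r)) (gnomonicScale r z • z)) = k r * p r z) :
    Tendsto (fun r => (∫ t, w t * Real.exp (∑ i, lam i * t i ^ 2 + ∑ i, tau i * t i)
        ∂(sphereSurfaceMeasure n r)) / (k r * poleSum lam tau r)) atTop
      (𝓝 (tangentGaussianIntegral lam tau q)) := by
  have h := tendsto_weighted_average (A := fun r => Real.exp (r * tau 0))
    (B := fun r => Real.exp (-(r * tau 0))) (fun r => Real.exp_pos _) (fun r => Real.exp_pos _)
    (tendsto_hemisphereIntegral (tau := tau) h_top hp hbound hlim 1)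
    (tendsto_hemisphereIntegral h_top hp hbound hlim (-1))
  refine h.congr' ?_
  filter_upwards [eventually_gt_atTop 0] with r hr
  have hkr := hk r hr
  rw [integral_mul_exp_sphereSurfaceMeasure lam tau hr hw (fun z => hwp r z 1 (by norm_num))
    (fun z => hwp r z (-1) (by norm_num)), poleSum]
  have : 0 < Real.exp (r * tau 0) + Real.exp (-(r * tau 0)) := by positivity
  field_simp

lemma abs_gnomonicScale_pow_le (r : ℝ) (z : Fin n → ℝ) (m : ℕ) :
    |gnomonicScale r z ^ m| ≤ 1 + ∑ i, (gnomonicScale r z * z i) ^ 2 := by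
  have h0 := gnomonicScale_pos r z
  have h1 : gnomonicScale r z ^ m ≤ 1 := pow_le_one₀ h0.le (gnomonicScale_le_one r z)
  have h2 : 0 ≤ ∑ i, (gnomonicScale r z * z i) ^ 2 := Finset.sum_nonneg fun i _ => sq_nonneg _
  rw [abs_of_pos (by positivity)]
  linarith

lemma sq_coord_le_sum (r : ℝ) (z : Fin n → ℝ) (j : Fin n) :
    (gnomonicScale r z * z j) ^ 2 ≤ ∑ i, (gnomonicScale r z * z i) ^ 2 :=
  Finset.single_le_sum (f := fun i => (gnomonicScale r z * z i) ^ 2) (fun _ _ => sq_nonneg _)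
    (Finset.mem_univ j)

lemma tendsto_gnomonicScale_mul_coord (z : Fin n → ℝ) (j : Fin n) :
    Tendsto (fun r : ℝ => gnomonicScale r z * z j) atTop (𝓝 (z j)) := by
  simpa using (tendsto_gnomonicScale z).mul_const (z j)

lemma tangentGaussianIntegral_one {lam tau : Fin (n + 1) → ℝ}
    (h_top : ∀ j : Fin n, lam j.succ < lam 0) :
    tangentGaussianIntegral lam tau 1 =
      Real.pi ^ ((n : ℝ) / 2) / (∏ i : Fin n, (lam 0 - lam i.succ) ^ (1 / 2 : ℝ)) *
        Real.exp (-∑ i : Fin n, tau i.succ ^ 2 / (4 * (lam i.succ - lam 0))) := by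
  simp only [tangentGaussianIntegral, Pi.one_apply, one_mul]
  rw [integral_exp_sum_quadratic (fun i => sub_pos.2 (h_top i)), ← Finset.sum_neg_distrib]
  congr 2
  refine Finset.sum_congr rfl fun i _ => ?_
  rw [← div_neg, ← mul_neg, neg_sub]

lemma tangentGaussianIntegral_one_pos {lam tau : Fin (n + 1) → ℝ}
    (h_top : ∀ j : Fin n, lam j.succ < lam 0) : 0 < tangentGaussianIntegral lam tau 1 := by
  rw [tangentGaussianIntegral_one h_top]
  have : 0 < ∏ i : Fin n, (lam 0 - lam i.succ) ^ (1 / 2 : ℝ) :=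
    Finset.prod_pos fun i _ => Real.rpow_pos_of_pos (sub_pos.2 (h_top i)) _
  positivity

lemma tendsto_fisherBingham_div_poleSum {lam tau : Fin (n + 1) → ℝ}
    (h_top : ∀ j : Fin n, lam j.succ < lam 0) :
    Tendsto (fun r => fisherBingham lam tau r / poleSum lam tau r) atTop
      (𝓝 (tangentGaussianIntegral lam tau 1)) := by
  have h := tendsto_moment_div_poleSum (tau := tau) h_top (w := fun _ => 1) continuous_const
    (p := fun _ _ => 1) (q := 1) (k := fun _ => 1) (fun _ => continuous_const)
    (fun r _ z => by simpa using abs_gnomonicScale_pow_le r z 0) (fun _ => tendsto_const_nhds)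
    (fun _ _ => one_ne_zero) (fun _ _ _ _ => by simp)
  simpa [fisherBingham] using h

lemma fisherBingham_isEquivalent {lam tau : Fin (n + 1) → ℝ}
    (h_top : ∀ j : Fin n, lam j.succ < lam 0) :
    (fun r : ℝ => fisherBingham lam tau r) ~[atTop]
      (fun r : ℝ => Real.pi ^ ((n : ℝ) / 2) / (∏ i : Fin n, (lam 0 - lam i.succ) ^ (1 / 2 : ℝ)) *
        (Real.exp (r * tau 0) + Real.exp (-(r * tau 0))) *
        Real.exp (r ^ 2 * lam 0 -
          ∑ i : Fin n, tau i.succ ^ 2 / (4 * (lam i.succ - lam 0)))) := by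
  refine isEquivalent_of_tendsto_div (D := poleSum lam tau)
    (tangentGaussianIntegral_one_pos (tau := tau) h_top).ne'
    (Eventually.of_forall fun r => (poleSum_pos lam tau r).ne')
    (tendsto_fisherBingham_div_poleSum h_top) (tendsto_const_nhds.congr fun r => ?_)
  rw [eq_div_iff (poleSum_pos lam tau r).ne', tangentGaussianIntegral_one h_top, poleSum,
    sub_eq_add_neg, Real.exp_add]
  ring

lemma fisherBinghamDerivLam_zero_isEquivalent {lam tau : Fin (n + 1) → ℝ}
    (h_top : ∀ j : Fin n, lam j.succ < lam 0) :
    (fun r : ℝ => fisherBinghamDerivLam 0 lam tau r) ~[atTop]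
      (fun r : ℝ => r ^ 2 * fisherBingham lam tau r) := by
  refine isEquivalent_of_tendsto_div (D := fun r => r ^ 2 * poleSum lam tau r)
    (tangentGaussianIntegral_one_pos (tau := tau) h_top).ne' ?_ ?_ ?_
  · filter_upwards [eventually_gt_atTop 0] with r hr
    exact mul_ne_zero (by positivity) (poleSum_pos lam tau r).ne'
  · have h := tendsto_moment_div_poleSum (tau := tau) h_top (w := fun t => t 0 ^ 2) (by fun_prop)
      (p := fun r z => gnomonicScale r z ^ 2) (q := 1) (k := fun r => r ^ 2) (fun r => by fun_prop)
      (fun r _ z => abs_gnomonicScale_pow_le r z 2)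
      (fun z => by simpa using (tendsto_gnomonicScale z).pow 2) (fun r hr => by positivity)
      (fun r z ε hε => by
        rw [consVec_zero]
        linear_combination (gnomonicScale r z * r) ^ 2 * hε)
    refine h.congr' ?_
    filter_upwards [eventually_gt_atTop 0] with r hr
    rw [fisherBinghamDerivLam, (hasDerivAt_fisherBingham_lam lam tau hr 0).deriv]
  · refine (tendsto_fisherBingham_div_poleSum h_top).congr' ?_
    filter_upwards [eventually_gt_atTop 0] with r hr
    rw [mul_div_mul_left _ _ (by positivity)]

lemma fisherBinghamDerivLam_succ_isEquivalent {lam tau : Fin (n + 1) → ℝ}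
    (h_top : ∀ j : Fin n, lam j.succ < lam 0) (j : Fin n) :
    (fun r : ℝ => fisherBinghamDerivLam j.succ lam tau r) ~[atTop]
      (fun r : ℝ => ((tau j.succ / (2 * (lam j.succ - lam 0))) ^ 2 +
        1 / (2 * (lam 0 - lam j.succ))) * fisherBingham lam tau r) := by
  have ha : 0 < lam 0 - lam j.succ := sub_pos.2 (h_top j)
  set K := (tau j.succ / (2 * (lam j.succ - lam 0))) ^ 2 + 1 / (2 * (lam 0 - lam j.succ)) with hK
  have hKpos : 0 < K := by positivity
  have hq : tangentGaussianIntegral lam tau (fun z => z j ^ 2) =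
      K * tangentGaussianIntegral lam tau 1 := by
    have h := integral_coord_mul_exp_sum_quadratic (fun i : Fin n => lam 0 - lam i.succ)
      (fun i => tau i.succ) j (integral_sq_mul_exp_quadratic ha (tau j.succ))
    have hK' : K = (tau j.succ / (2 * (lam 0 - lam j.succ))) ^ 2 +
        1 / (2 * (lam 0 - lam j.succ)) := by
      rw [hK, ← neg_sub (lam 0), mul_neg, div_neg, neg_sq]
    simpa [tangentGaussianIntegral, hK'] using h
  refine isEquivalent_of_tendsto_div (D := poleSum lam tau)
    (L := tangentGaussianIntegral lam tau (fun z => z j ^ 2)) ?_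
    (Eventually.of_forall fun r => (poleSum_pos lam tau r).ne') ?_ ?_
  · rw [hq]
    exact (mul_pos hKpos (tangentGaussianIntegral_one_pos h_top)).ne'
  · have h := tendsto_moment_div_poleSum (tau := tau) h_top (w := fun t => t j.succ ^ 2)
      (by fun_prop) (p := fun r z => (gnomonicScale r z * z j) ^ 2) (q := fun z => z j ^ 2)
      (k := fun _ => 1) (fun r => by fun_prop)
      (fun r _ z => by
        rw [abs_of_nonneg (sq_nonneg _)]
        linarith [sq_coord_le_sum r z j])
      (fun z => (tendsto_gnomonicScale_mul_coord z j).pow 2) (fun _ _ => one_ne_zero)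
      (fun r z ε _ => by simp)
    refine h.congr' ?_
    filter_upwards [eventually_gt_atTop 0] with r hr
    rw [fisherBinghamDerivLam, (hasDerivAt_fisherBingham_lam lam tau hr j.succ).deriv, one_mul]
  · rw [hq]
    simpa only [mul_div_assoc] using (tendsto_fisherBingham_div_poleSum h_top).const_mul K

lemma fisherBinghamDerivTau_zero_eq (lam tau : Fin (n + 1) → ℝ) {r : ℝ} (hr : 0 < r) :
    fisherBinghamDerivTau 0 lam tau r = r * Real.exp (r ^ 2 * lam 0) *
      (Real.exp (r * tau 0) * hemisphereIntegral lam tau gnomonicScale 1 r -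
        Real.exp (-(r * tau 0)) * hemisphereIntegral lam tau gnomonicScale (-1) r) := by
  rw [fisherBinghamDerivTau, (hasDerivAt_fisherBingham_tau lam tau hr 0).deriv,
    integral_mul_exp_sphereSurfaceMeasure lam tau hr (w := fun t => t 0) (by fun_prop)
      (p := gnomonicScale) (k := r) (l := -r) (fun z => by simp [mul_comm])
      (fun z => by simp [mul_comm])]
  ring

lemma fisherBinghamDerivTau_zero_isEquivalent {lam tau : Fin (n + 1) → ℝ}
    (h_top : ∀ j : Fin n, lam j.succ < lam 0) :
    (fun r : ℝ => fisherBinghamDerivTau 0 lam tau r) ~[atTop]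
      (fun r : ℝ => r * ((Real.exp (r * tau 0) - Real.exp (-(r * tau 0))) /
        (Real.exp (r * tau 0) + Real.exp (-(r * tau 0)))) * fisherBingham lam tau r) := by
  by_cases h0 : tau 0 = 0
  -- The sign `ε` enters the hemisphere integrals only through `ε * tau 0`, so here the two
  -- hemispheres cancel exactly.
  · refine EventuallyEq.isEquivalent ?_
    filter_upwards [eventually_gt_atTop 0] with r hr
    rw [fisherBinghamDerivTau_zero_eq lam tau hr]
    simp [h0, hemisphereIntegral]
  have hne : ∀ r, 0 < r → Real.exp (r * tau 0) - Real.exp (-(r * tau 0)) ≠ 0 := fun r hr => by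
    rw [Ne, sub_eq_zero, Real.exp_eq_exp]
    intro h
    have : r * tau 0 = 0 := by linarith
    simp [hr.ne', h0] at this
  -- Normalizing by the difference of exponentials gives both sides the same positive limit,
  -- whatever the sign of `tau 0`.
  refine isEquivalent_of_tendsto_div (D := fun r => r * Real.exp (r ^ 2 * lam 0) *
      (Real.exp (r * tau 0) - Real.exp (-(r * tau 0))))
    (tangentGaussianIntegral_one_pos (tau := tau) h_top).ne' ?_ ?_ ?_
  · filter_upwards [eventually_gt_atTop 0] with r hr
    exact mul_ne_zero (by positivity) (hne r hr)
  · have hG := tendsto_hemisphereIntegral (tau := tau) h_top (p := gnomonicScale) (q := 1)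
      continuous_gnomonicScale (fun r _ z => by simpa using abs_gnomonicScale_pow_le r z 1)
      tendsto_gnomonicScale
    refine (tendsto_weighted_difference h0 (hG 1) (hG (-1))).congr' ?_
    filter_upwards [eventually_gt_atTop 0] with r hr
    rw [fisherBinghamDerivTau_zero_eq lam tau hr, mul_div_mul_left _ _ (by positivity)]
  · refine (tendsto_fisherBingham_div_poleSum h_top).congr' ?_
    filter_upwards [eventually_gt_atTop 0] with r hr
    have h1 := hne r hr
    have h2 : 0 < Real.exp (r * tau 0) + Real.exp (-(r * tau 0)) := by positivity
    rw [poleSum]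
    field_simp

lemma fisherBinghamDerivTau_succ_isEquivalent {lam tau : Fin (n + 1) → ℝ}
    (h_top : ∀ j : Fin n, lam j.succ < lam 0) (j : Fin n) :
    (fun r : ℝ => fisherBinghamDerivTau j.succ lam tau r) ~[atTop]
      (fun r : ℝ => tau j.succ / (2 * (lam 0 - lam j.succ)) * fisherBingham lam tau r) := by
  by_cases hj : tau j.succ = 0
  -- The limiting moment is zero here, so comparison of limits says nothing; the reflection symmetry
  -- gives exact vanishing.
  · refine EventuallyEq.isEquivalent ?_
    filter_upwards [eventually_gt_atTop 0] with r hr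
    rw [fisherBinghamDerivTau, (hasDerivAt_fisherBingham_tau lam tau hr j.succ).deriv,
      integral_mul_exp_sphereSurfaceMeasure lam tau hr (w := fun t => t j.succ) (by fun_prop)
        (p := fun r z => gnomonicScale r z * z j) (k := 1) (l := 1) (fun z => by simp)
        (fun z => by simp)]
    simp [hemisphereIntegral_coord_eq_zero lam hj, hj]
  have ha : 0 < lam 0 - lam j.succ := sub_pos.2 (h_top j)
  set K := tau j.succ / (2 * (lam 0 - lam j.succ)) with hK
  have hK0 : K ≠ 0 := div_ne_zero hj (by positivity)
  have hq : tangentGaussianIntegral lam tau (fun z => z j) =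
      K * tangentGaussianIntegral lam tau 1 := by
    have h := integral_coord_mul_exp_sum_quadratic (fun i : Fin n => lam 0 - lam i.succ)
      (fun i => tau i.succ) j (integral_id_mul_exp_quadratic ha (tau j.succ))
    simpa [tangentGaussianIntegral] using h
  refine isEquivalent_of_tendsto_div (D := poleSum lam tau)
    (L := tangentGaussianIntegral lam tau (fun z => z j)) ?_
    (Eventually.of_forall fun r => (poleSum_pos lam tau r).ne') ?_ ?_
  · rw [hq]
    exact mul_ne_zero hK0 (tangentGaussianIntegral_one_pos h_top).ne'
  · have h := tendsto_moment_div_poleSum (tau := tau) h_top (w := fun t => t j.succ)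
      (by fun_prop) (p := fun r z => gnomonicScale r z * z j) (q := fun z => z j)
      (k := fun _ => 1) (fun r => by fun_prop)
      (fun r _ z => by
        have h1 := sq_coord_le_sum r z j
        rw [abs_le]
        constructor <;> nlinarith [sq_nonneg (gnomonicScale r z * z j - 1),
          sq_nonneg (gnomonicScale r z * z j + 1)])
      (fun z => tendsto_gnomonicScale_mul_coord z j) (fun _ _ => one_ne_zero)
      (fun r z ε _ => by simp)
    refine h.congr' ?_
    filter_upwards [eventually_gt_atTop 0] with r hr
    rw [fisherBinghamDerivTau, (hasDerivAt_fisherBingham_tau lam tau hr j.succ).deriv, one_mul]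
  · rw [hq]
    simpa only [mul_div_assoc] using (tendsto_fisherBingham_div_poleSum h_top).const_mul K

end Main

open Filter Asymptotics in
theorem proposition1 (n : ℕ) (lam tau : Fin (n + 1) → ℝ)
    (h_neg : lam 0 < 0) (h_top : ∀ j : Fin n, lam j.succ < lam 0) (h_anti : Antitone lam) :
    -- the partial derivatives exist
    (∀ r : ℝ, 0 < r → ∀ j : Fin (n + 1),
      DifferentiableAt ℝ (fun x => fisherBingham (Function.update lam j x) tau r) (lam j) ∧
      DifferentiableAt ℝ (fun x => fisherBingham lam (Function.update tau j x) r) (tau j)) ∧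
    (fun r : ℝ => fisherBingham lam tau r) ~[atTop]
      (fun r : ℝ => Real.pi ^ ((n : ℝ) / 2) / (∏ i : Fin n, (lam 0 - lam i.succ) ^ (1 / 2 : ℝ)) *
        (Real.exp (r * tau 0) + Real.exp (-(r * tau 0))) *
        Real.exp (r ^ 2 * lam 0 - ∑ i : Fin n, tau i.succ ^ 2 / (4 * (lam i.succ - lam 0)))) ∧
    (fun r : ℝ => fisherBinghamDerivLam 0 lam tau r) ~[atTop]
      (fun r : ℝ => r ^ 2 * fisherBingham lam tau r) ∧
    (∀ j : Fin n, (fun r : ℝ => fisherBinghamDerivLam j.succ lam tau r) ~[atTop]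
      (fun r : ℝ => ((tau j.succ / (2 * (lam j.succ - lam 0))) ^ 2 +
        1 / (2 * (lam 0 - lam j.succ))) * fisherBingham lam tau r)) ∧
    (fun r : ℝ => fisherBinghamDerivTau 0 lam tau r) ~[atTop]
      (fun r : ℝ => r * ((Real.exp (r * tau 0) - Real.exp (-(r * tau 0))) /
        (Real.exp (r * tau 0) + Real.exp (-(r * tau 0)))) * fisherBingham lam tau r) ∧
    (∀ j : Fin n, (fun r : ℝ => fisherBinghamDerivTau j.succ lam tau r) ~[atTop]
      (fun r : ℝ => tau j.succ / (2 * (lam 0 - lam j.succ)) * fisherBingham lam tau r)) := by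
  exact ⟨fun r hr j => ⟨(hasDerivAt_fisherBingham_lam lam tau hr j).differentiableAt,
      (hasDerivAt_fisherBingham_tau lam tau hr j).differentiableAt⟩,
    fisherBingham_isEquivalent h_top, fisherBinghamDerivLam_zero_isEquivalent h_top,
    fisherBinghamDerivLam_succ_isEquivalent h_top, fisherBinghamDerivTau_zero_isEquivalent h_top,
    fisherBinghamDerivTau_succ_isEquivalent h_top⟩
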